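/- All topological spaces, in particular all topological groups, are assumed to be Hausdorff. A perfect homomorphism of topological groups is a homomorphism $\pi : G \to H$ that is continuous, closed, surjective, and has compact fibers $\pi^{-1}(y)$ for all $y \in H$. A topological group $G$ is called $P\mathcal{M}$-factorizable (respectively, $P\mathbb{R}$-factorizable) if for every continuous function $f : G \to \mathbb{R}$ there exist a perfect homomorphism $\pi : G \to H$ onto a metrizable (respectively, second-countable) topological group $H$ and a continuous function $g : H \to \mathbb{R}$ such that $f = g \circ \pi$. **Theorem.** A topological group $G$ is $P\mathcal{M}$-factorizable if and only if at least one of the following holds: 1. $G$ is metrizable; 2. $G$ is $P\mathbb{R}$-factorizable. -/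

import Mathlib

universe u

/-- A perfect mapping: a continuous closed surjection all of whose fibers are compact. -/
structure IsPerfectMap {X Y : Type*} [TopologicalSpace X] [TopologicalSpace Y]
    (f : X → Y) : Prop where
  continuous : Continuous f
  isClosedMap : IsClosedMap f
  surjective : Function.Surjective f
  isCompact_fiber : ∀ y : Y, IsCompact (f ⁻¹' {y})

/-- `G` is PM-factorizable: every continuous real-valued function on `G` factors through a
perfect homomorphism onto a metrizable topological group.  (Since `H` is an image of `G`, letting
`H` range over the universe of `G` is no restriction.) -/
def IsPMFactorizable (G : Type u) [Group G] [TopologicalSpace G] : Prop :=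
  ∀ f : G → ℝ, Continuous f →
    ∃ (H : Type u) (_ : Group H) (_ : TopologicalSpace H),
      IsTopologicalGroup H ∧ TopologicalSpace.MetrizableSpace H ∧
      ∃ π : G →* H, IsPerfectMap π ∧ ∃ g : H → ℝ, Continuous g ∧ f = g ∘ π

/-- `G` is PR-factorizable: every continuous real-valued function on `G` factors through a
perfect homomorphism onto a (Hausdorff) second-countable topological group. -/
def IsPRFactorizable (G : Type u) [Group G] [TopologicalSpace G] : Prop :=
  ∀ f : G → ℝ, Continuous f →
    ∃ (H : Type u) (_ : Group H) (_ : TopologicalSpace H),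
      IsTopologicalGroup H ∧ T2Space H ∧ SecondCountableTopology H ∧
      ∃ π : G →* H, IsPerfectMap π ∧ ∃ g : H → ℝ, Continuous g ∧ f = g ∘ π

open Topology TopologicalSpace Filter Set

/-! Let `π : G → H` be perfect with `H` metrizable, `G` PM-factorizable and not metrizable. The
compact kernel `N` is not metrizable, so the restrictions to `N` of continuous functions on `G` are
not separable. Were `H` not second-countable either, one could put uncountably many uniformly
separated restrictions on uniformly separated cosets of `N`, glued into a single continuous `f`. But
`f` factors through some `π'` onto a metrizable group, so its translates restricted to `N` come from
functions on the compact metrizable set `π' '' N` and form a separable set: contradiction. -/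

/-- A pseudometric space that is not second-countable has an uncountable `ε`-separated subset for
some `ε > 0`. -/
theorem exists_uncountable_separated {X : Type*} [PseudoMetricSpace X]
    (h : ¬ SecondCountableTopology X) :
    ∃ ε > 0, ∃ s : Set X, ¬ s.Countable ∧ s.Pairwise fun x y => ε < dist x y := by
  by_contra! hc
  refine h (Metric.secondCountable_of_almost_dense_set fun ε hε => ?_)
  obtain ⟨s, hs⟩ := zorn_subset {s : Set X | s.Pairwise fun x y => ε < dist x y}
    fun c hc hchain => ⟨⋃₀ c, (pairwise_sUnion hchain.directedOn).2 fun s hs => hc hs,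
      fun s hs => subset_sUnion_of_mem hs⟩
  refine ⟨s, by_contra fun hcount => hc ε hε s hcount hs.prop, fun x => ?_⟩
  by_contra! hx
  have hmem : x ∈ s := by
    refine hs.mem_of_prop_insert (hs.prop.insert fun y hy _ => ?_)
    exact ⟨hx y hy, by rw [dist_comm]; exact hx y hy⟩
  exact (hx x hmem).not_ge (by simpa using hε.le)

/-- A uniformly separated family in a separable subset of a pseudometric space has countable index
type. -/
theorem countable_of_separated_of_isSeparable {X ι : Type*} [PseudoMetricSpace X] {s : Set X}
    (hs : IsSeparable s) {ε : ℝ} (hε : 0 < ε) {x : ι → X} (hxs : ∀ i, x i ∈ s)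
    (hx : Pairwise fun i j => ε < dist (x i) (x j)) : Countable ι := by
  have : SeparableSpace s := hs.separableSpace
  refine Pairwise.countable_of_isOpen_disjoint
    (s := fun i => Metric.ball (⟨x i, hxs i⟩ : s) (ε / 2)) (fun i j hij => ?_)
    (fun i => Metric.isOpen_ball) (fun i => ⟨_, Metric.mem_ball_self (half_pos hε)⟩)
  refine Metric.ball_disjoint_ball ?_
  have := hx hij
  rw [add_halves]
  exact this.le

/-- Given a uniformly separated family of points in the codomain of a continuous map, continuous
functions can be prescribed simultaneously on the fibers over these points. -/
theorem exists_continuous_eqOn_fibers {X Y ι : Type*} [TopologicalSpace X] [PseudoMetricSpace Y]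
    {p : X → Y} (hp : Continuous p) {ε : ℝ} (hε : 0 < ε) {y : ι → Y}
    (hy : Pairwise fun i j => ε < dist (y i) (y j)) (φ : ι → C(X, ℝ)) :
    ∃ f : X → ℝ, Continuous f ∧ ∀ i a, p a = y i → f a = φ i a := by
  -- Bumps of radius `ε / 4` around the `y i`: a ball of that radius meets at most one of them.
  set ψ : ι → X → ℝ := fun i a => max 0 (1 - 4 / ε * dist (p a) (y i)) * φ i a with hψ
  have hψ_zero : ∀ i a, ε / 4 ≤ dist (p a) (y i) → ψ i a = 0 := fun i a h => by
    have : 1 ≤ 4 / ε * dist (p a) (y i) := by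
      rw [div_mul_eq_mul_div, le_div_iff₀ hε]
      linarith
    simp only [hψ]
    rw [max_eq_left (by linarith), zero_mul]
  refine ⟨fun a => ∑ᶠ i, ψ i a, continuous_finsum (fun i => ?_) fun a => ?_, fun i a hi => ?_⟩
  · have := (φ i).continuous
    simp only [hψ]
    fun_prop
  · refine ⟨p ⁻¹' Metric.ball (p a) (ε / 4),
      hp.continuousAt.preimage_mem_nhds (Metric.ball_mem_nhds _ (by positivity)), ?_⟩
    refine Set.Subsingleton.finite fun i hi j hj => ?_
    obtain ⟨b, hb, hba⟩ := hi
    obtain ⟨c, hc, hca⟩ := hj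
    by_contra hij
    have h1 : dist (p b) (y i) < ε / 4 := by
      by_contra! h
      exact hb (hψ_zero i b h)
    have h2 : dist (p c) (y j) < ε / 4 := by
      by_contra! h
      exact hc (hψ_zero j c h)
    have h3 : dist (p b) (p a) < ε / 4 := hba
    have h4 : dist (p c) (p a) < ε / 4 := hca
    have h5 : ε < dist (y i) (y j) := hy hij
    have h6 := dist_triangle4 (y i) (p b) (p a) (y j)
    have h7 := dist_triangle (p a) (p c) (y j)
    rw [dist_comm (y i) (p b)] at h6
    rw [dist_comm (p a) (p c)] at h7
    linarith
  · dsimp only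
    rw [finsum_eq_single _ i fun j hj => hψ_zero j a ?_]
    · simp [hψ, hi]
    · rw [hi]
      linarith [hy hj.symm]

/-- A compact space on which a separable family of continuous functions separates points is
metrizable. -/
theorem metrizableSpace_of_isSeparable_separatesPoints {K : Type*} [TopologicalSpace K]
    [CompactSpace K] {R : Set C(K, ℝ)} (hR : IsSeparable R)
    (hsep : ∀ a b, a ≠ b → ∃ f ∈ R, f a ≠ f b) : MetrizableSpace K := by
  obtain ⟨D, hD, hRD⟩ := hR
  have : Countable D := hD
  have hcont : Continuous fun (a : K) (f : D) => f.1 a :=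
    continuous_pi fun f => f.1.continuous
  refine (hcont.isClosedEmbedding fun a b hab => ?_).isEmbedding.metrizableSpace
  by_contra hne
  obtain ⟨f, hf, hfab⟩ := hsep a b hne
  have hclosed : IsClosed {f : C(K, ℝ) | f a = f b} :=
    isClosed_eq (continuous_eval_const a) (continuous_eval_const b)
  exact hfab (closure_minimal (fun g hg => congrFun hab ⟨g, hg⟩) hclosed (hRD hf))

/-- A regular space is first-countable at `x` if it admits a closed map to another space such that
the target is first-countable at the image of `x`, and the fiber through `x` is first-countable at
`x`. -/
theorem isCountablyGenerated_nhds_of_isClosedMap {X Y : Type*} [TopologicalSpace X]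
    [TopologicalSpace Y] [RegularSpace X] {p : X → Y} (hp : Continuous p) (hcl : IsClosedMap p)
    (x : X) [(𝓝 (p x)).IsCountablyGenerated]
    [(𝓝[p ⁻¹' {p x}] x).IsCountablyGenerated] : (𝓝 x).IsCountablyGenerated := by
  obtain ⟨V, hV⟩ := (𝓝[p ⁻¹' {p x}] x).exists_antitone_basis
  have hO : ∀ n, ∃ O ∈ 𝓝 x, IsClosed O ∧ O ∩ p ⁻¹' {p x} ⊆ V n := fun n => by
    obtain ⟨W, hW, hWV⟩ := mem_nhdsWithin_iff_exists_mem_nhds_inter.1 (hV.mem n)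
    obtain ⟨O, hO, hOc, hOW⟩ := exists_mem_nhds_isClosed_subset hW
    exact ⟨O, hO, hOc, (inter_subset_inter_left _ hOW).trans hWV⟩
  choose O hO hOc hOV using hO
  -- Closedness of `p` gives the tube: near `p x`, the part of `O n` over a point stays in `U'`.
  have key : 𝓝 x = comap p (𝓝 (p x)) ⊓ ⨅ n, 𝓟 (O n) := by
    refine le_antisymm (le_inf hp.continuousAt.le_comap
      (le_iInf fun n => le_principal_iff.2 (hO n))) fun U hU => ?_
    obtain ⟨U', hU'U, hU'o, hxU'⟩ := mem_nhds_iff.1 hU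
    obtain ⟨n, -, hn⟩ := hV.toHasBasis.mem_iff.1 (mem_nhdsWithin_of_mem_nhds (hU'o.mem_nhds hxU'))
    have hfib : p x ∉ p '' (O n \ U') := by
      rintro ⟨z, ⟨hzO, hzU⟩, hz⟩
      exact hzU (hn (hOV n ⟨hzO, hz⟩))
    have hmem : (p '' (O n \ U'))ᶜ ∈ 𝓝 (p x) :=
      (hcl _ ((hOc n).sdiff hU'o)).isOpen_compl.mem_nhds hfib
    refine mem_of_superset (inter_mem_inf (preimage_mem_comap hmem)
      (mem_iInf_of_mem n (mem_principal_self (O n)))) ?_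
    rintro z ⟨hz1, hz2⟩
    refine hU'U (by_contra fun hz => hz1 ⟨z, ⟨hz2, hz⟩, rfl⟩)
  rw [key]
  infer_instance

/-- The Birkhoff–Kakutani theorem for Hausdorff groups. -/
theorem metrizableSpace_of_isCountablyGenerated_nhds_one {G : Type*} [Group G]
    [TopologicalSpace G] [IsTopologicalGroup G] [T2Space G] [(𝓝 (1 : G)).IsCountablyGenerated] :
    MetrizableSpace G := by
  let _ := IsTopologicalGroup.rightUniformSpace G
  have : (uniformity G).IsCountablyGenerated := by
    rw [uniformity_eq_comap_nhds_one']
    infer_instance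
  exact UniformSpace.metrizableSpace

/-- The extension of a metrizable group by a compact metrizable kernel is metrizable. -/
theorem IsPerfectMap.metrizableSpace {G H : Type*} [Group G] [TopologicalSpace G]
    [IsTopologicalGroup G] [T2Space G] [Group H] [TopologicalSpace H] [MetrizableSpace H]
    {π : G →* H} (hπ : IsPerfectMap π) [MetrizableSpace (π ⁻¹' {1})] : MetrizableSpace G := by
  have hfib : (𝓝[π ⁻¹' {π 1}] (1 : G)).IsCountablyGenerated := by
    rw [map_one, nhdsWithin_eq_map_subtype_coe (show (1 : G) ∈ π ⁻¹' {1} by simp)]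
    infer_instance
  have : FirstCountableTopology H := by
    let _ := metrizableSpaceMetric H
    infer_instance
  have := isCountablyGenerated_nhds_of_isClosedMap hπ.continuous hπ.isClosedMap (1 : G)
  exact metrizableSpace_of_isCountablyGenerated_nhds_one

/-- The restrictions to a compact set `N` of the translates of a function which factors through a
continuous homomorphism to a metrizable group form a separable set. -/
theorem isSeparable_translates {G H : Type*} [Group G] [TopologicalSpace G] [Group H]
    [TopologicalSpace H] [IsTopologicalGroup H] [MetrizableSpace H] {π : G →* H}
    (hπ : Continuous π) {g : H → ℝ} (hg : Continuous g) (N : Set G) [CompactSpace N] :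
    IsSeparable {h : C(N, ℝ) | ∃ x, ∀ n : N, h n = g (π (x * n))} := by
  have hM : IsCompact (π '' N) := (isCompact_iff_compactSpace.2 ‹_›).image hπ
  have : CompactSpace (π '' N) := isCompact_iff_compactSpace.1 hM
  let _ := metrizableSpaceMetric H
  let q : C(N, π '' N) := ⟨fun n => ⟨π n, mem_image_of_mem π n.2⟩, by fun_prop⟩
  refine (isSeparable_range (ContinuousMap.continuous_precomp (Z := ℝ) q)).mono ?_
  rintro h ⟨x, hx⟩
  refine ⟨⟨fun m => g (π x * m), by fun_prop⟩, ?_⟩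
  ext n
  simp [hx, q]

/-- Cardinals are comparable, so the smaller separated set can index both families. -/
theorem exists_uncountable_separated_pair {X Y : Type u} [PseudoMetricSpace X]
    [PseudoMetricSpace Y] (hX : ¬ SecondCountableTopology X) (hY : ¬ SecondCountableTopology Y) :
    ∃ (ι : Type u) (x : ι → X) (y : ι → Y) (ε δ : ℝ), Uncountable ι ∧ 0 < ε ∧ 0 < δ ∧
      (Pairwise fun i j => ε < dist (x i) (x j)) ∧ Pairwise fun i j => δ < dist (y i) (y j) := by
  obtain ⟨ε, hε, s, hs, hsp⟩ := exists_uncountable_separated hX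
  obtain ⟨δ, hδ, t, ht, htp⟩ := exists_uncountable_separated hY
  have hsp' : Pairwise fun i j : s => ε < dist (i : X) j := fun i j hij =>
    hsp i.2 j.2 (Subtype.coe_injective.ne hij)
  have htp' : Pairwise fun i j : t => δ < dist (i : Y) j := fun i j hij =>
    htp i.2 j.2 (Subtype.coe_injective.ne hij)
  rcases Function.Embedding.total s t with ⟨⟨e⟩⟩ | ⟨⟨e⟩⟩
  · exact ⟨s, fun i => i, fun i => e i, ε, δ, not_countable_iff.1 hs, hε, hδ, hsp',
      fun i j hij => htp' (e.injective.ne hij)⟩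
  · exact ⟨t, fun i => e i, fun i => i, ε, δ, not_countable_iff.1 ht, hε, hδ,
      fun i j hij => hsp' (e.injective.ne hij), htp'⟩

/-- A perfect homomorphism from a non-metrizable PM-factorizable group to a metrizable group has
second-countable image. -/
theorem IsPMFactorizable.secondCountableTopology {G H : Type u} [Group G] [TopologicalSpace G]
    [IsTopologicalGroup G] [T2Space G] (hG : IsPMFactorizable G) (hm : ¬ MetrizableSpace G)
    [Group H] [TopologicalSpace H] [MetrizableSpace H] {π : G →* H} (hπ : IsPerfectMap π) :
    SecondCountableTopology H := by
  by_contra hH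
  let _ := metrizableSpaceMetric H
  let N : Set G := π ⁻¹' {1}
  have : CompactSpace N := isCompact_iff_compactSpace.1 (hπ.isCompact_fiber 1)
  let R : Set C(N, ℝ) := range fun φ : C(G, ℝ) => φ.restrict N
  have hR : ¬ SecondCountableTopology R := fun h => by
    have hRs : IsSeparable R := IsSeparable.of_subtype R
    have : MetrizableSpace N := metrizableSpace_of_isSeparable_separatesPoints hRs fun a b hab => by
      let _ := IsTopologicalGroup.rightUniformSpace G
      obtain ⟨f, hf, hfa, hfb⟩ := CompletelyRegularSpace.completely_regular (a : G) {(b : G)}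
        isClosed_singleton fun h => hab (Subtype.ext h)
      refine ⟨_, ⟨⟨fun z => (f z : ℝ), by fun_prop⟩, rfl⟩, ?_⟩
      simp [hfa, hfb rfl]
    exact hm hπ.metrizableSpace
  obtain ⟨ι, x, y, ε, δ, hι, hε, hδ, hx, hy⟩ := exists_uncountable_separated_pair hH hR
  choose a ha using fun i => hπ.surjective (x i)
  choose φ hφ using fun i => (y i).2
  -- The fiber over `x i` is the coset `a i * N`; there `f (a i * n) = φ i n`.
  obtain ⟨f, hf, hfφ⟩ := exists_continuous_eqOn_fibers hπ.continuous hε hx fun i =>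
    (φ i).comp ⟨fun z => (a i)⁻¹ * z, by fun_prop⟩
  obtain ⟨H', _, _, _, _, π', hπ', g, hg, rfl⟩ := hG f hf
  refine not_countable (α := ι) (countable_of_separated_of_isSeparable
    (isSeparable_translates hπ'.continuous hg N) hδ (x := fun i => (y i : C(N, ℝ)))
    (fun i => ⟨a i, fun n => ?_⟩) hy)
  have hn : π n = 1 := n.2
  have := hfφ i (a i * n) (by simp [ha, hn])
  rw [← hφ i]
  simpa using this.symm

theorem theorem3p7 (G : Type u) [Group G] [TopologicalSpace G] [IsTopologicalGroup G]
    [T2Space G] :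
    IsPMFactorizable G ↔ (TopologicalSpace.MetrizableSpace G ∨ IsPRFactorizable G) := by
  refine ⟨fun hG => or_iff_not_imp_left.2 fun hm f hf => ?_, ?_⟩
  · obtain ⟨H, _, _, hH, _, π, hπ, h⟩ := hG f hf
    exact ⟨H, _, _, hH, inferInstance, hG.secondCountableTopology hm hπ, π, hπ, h⟩
  · rintro (hm | hG) f hf
    · refine ⟨G, _, _, ‹_›, hm, MonoidHom.id G, ⟨continuous_id, IsClosedMap.id,
        Function.surjective_id, fun y => ?_⟩, f, hf, rfl⟩
      exact isCompact_singleton (x := y)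
    -- A Hausdorff group is regular, so Urysohn metrization applies to `H`.
    · obtain ⟨H, _, _, hH, _, _, h⟩ := hG f hf
      exact ⟨H, _, _, hH, inferInstance, h⟩
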